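/- Let $k>1$ be a fixed integer. For a finite simple undirected graph $G=(V,E)$, a set $D\subseteq V$ is \emph{$k$-dominating} if every vertex in $V\setminus D$ has at least $k$ neighbours in $D$; a set $S\subseteq V$ is a \emph{$k$-nonblocker set} of $G$ if $V\setminus S$ is $k$-dominating. Let $m^*(G)$ denote the maximum size of a $k$-nonblocker set of $G$. Then there is a polynomial-time algorithm (a Turing machine that, given the adjacency matrix of a finite simple undirected graph $G$, runs in time polynomial in the length of the input) which, for every such $G$, computes a $k$-nonblocker set $S$ of $G$ with $$|S|\;\ge\;\frac{m^*(G)}{k+1}-k .$$ -/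

import Mathlib

namespace KNonblocker

open Classical in
/-- `D` is a `k`-dominating set of `G`: every vertex outside `D` has at least `k` neighbours
in `D`. -/
def IsKDominating {V : Type*} (G : SimpleGraph V) (k : ℕ) (D : Finset V) : Prop :=
  ∀ x, x ∉ D → k ≤ (D.filter fun y => G.Adj x y).card

open Classical in
/-- `S` is a `k`-nonblocker set of `G`: its complement is a `k`-dominating set. -/
def IsKNonblocker {V : Type*} [Fintype V] (G : SimpleGraph V) (k : ℕ) (S : Finset V) : Prop :=
  IsKDominating G k (Finset.univ \ S)

open Classical in
/-- The optimum value of `k`-Nonblocker on `G`, i.e. the largest size of a `k`-nonblocker set.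
(The maximum is over a nonempty collection: the empty set is always a `k`-nonblocker set.) -/
noncomputable def maxKNonblocker {V : Type*} [Fintype V] (G : SimpleGraph V) (k : ℕ) : ℕ :=
  (Finset.univ.filter fun S : Finset V => IsKNonblocker G k S).sup Finset.card

/-- An instance of `k`-Nonblocker: a finite simple undirected graph, with vertices numbered
`0, …, n - 1`. -/
abbrev Instance : Type := Σ n : ℕ, SimpleGraph (Fin n)

open Classical in
/-- Row `i` of the adjacency matrix, one symbol `some b` per bit `b`, closed by the separator
`none`. -/
noncomputable def encodeRow {n : ℕ} (G : SimpleGraph (Fin n)) (i : Fin n) : List (Option Bool) :=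
  (List.ofFn fun j : Fin n => some (decide (G.Adj i j))) ++ [none]

/-- The adjacency matrix, row by row, as a word over the alphabet `{0, 1, #}`; its length is
`n * (n + 1)`. -/
noncomputable def encodeInstance (x : Instance) : List (Option Bool) :=
  (List.ofFn fun i : Fin x.1 => encodeRow x.2 i).flatten

open Classical in
/-- A set of vertices as its characteristic bit string, of length `n`. -/
noncomputable def encodeSet {n : ℕ} (S : Finset (Fin n)) : List Bool :=
  List.ofFn fun i : Fin n => decide (i ∈ S)

theorem encodeInstance_length (x : Instance) :
    (encodeInstance x).length = x.1 * (x.1 + 1) := by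
  simp [encodeInstance, encodeRow, List.length_flatten, List.map_ofFn, Function.comp_def]

theorem encodeInstance_injective : Function.Injective encodeInstance := by
  rintro ⟨n, G⟩ ⟨m, H⟩ h
  have hl := congrArg List.length h
  rw [encodeInstance_length, encodeInstance_length] at hl
  have hnm : n = m := by
    dsimp only at hl
    rcases lt_trichotomy n m with h1 | h1 | h1
    · nlinarith
    · exact h1
    · nlinarith
  subst hnm
  have h2 : (List.ofFn fun i => encodeRow G i) = List.ofFn fun i => encodeRow H i := by
    refine List.eq_iff_flatten_eq.2 ⟨h, ?_⟩
    simp [List.map_ofFn, Function.comp_def, encodeRow]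
  have h3 := List.ofFn_injective h2
  congr 1
  ext i j
  have h4 := congrFun h3 i
  simp only [encodeRow, List.append_cancel_right_eq] at h4
  have h5 := congrFun (List.ofFn_injective h4) j
  simpa using h5

theorem encodeSet_injective {n : ℕ} :
    Function.Injective (encodeSet : Finset (Fin n) → List Bool) := by
  intro S T h
  ext i
  simpa using congrFun (List.ofFn_injective h) i

end KNonblocker

namespace KNonblocker

/-! ### Reachability within a bounded number of steps -/

open Turing TM2.Stmt

/-! A greedy colouring with `k + 1` colours works. All vertices start with colour 0 and are treated
once each, in order. If at least `k` neighbours of `v` do not have colour 0, then `v` keeps 0.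
Otherwise, if `v` has degree less than `k`, it is discarded (`none`). Otherwise fewer than `k`
neighbours avoid colour 0, so one of the `k` nonzero colours is absent from the neighbourhood; `v`
takes it, and all of its at least `k` neighbours then differ from it. A later recolouring never
harms a treated vertex: the new colour is absent from the neighbourhood of the recoloured vertex, so
no neighbour loses a differently coloured neighbour (`Settled.update`, `settled_colourRows`).

In the end every colour class is a `k`-nonblocker set, and a discarded vertex lies in no such set,
its degree being too small. The `k + 1` classes thus cover every `k`-nonblocker set, and the largest
has size at least `m^*/(k+1)`; the additive loss `k` is not needed.

For fixed `k`, the choice at a vertex depends only on neighbour counts capped at `k`, so a finite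
automaton makes it while reading the matrix row alongside the stack of earlier colours. Unary
counters then single out a largest class (`evals_fight`). The total time is quadratic in the number
of vertices, hence linear in the input length. -/

/-- `b` is reached from `a` in at most `n` iterations of the partial function `f`. -/
def EvalsWithin {α : Type*} (f : α → Option α) (n : ℕ) (a b : α) : Prop :=
  ∃ m ≤ n, (flip bind f)^[m] (some a) = some b

namespace EvalsWithin

variable {α : Type*} {f : α → Option α} {m n : ℕ} {a b c : α}

theorem refl (a : α) : EvalsWithin f 0 a a := ⟨0, le_rfl, rfl⟩

theorem head (h : f a = some b) (h' : EvalsWithin f n b c) : EvalsWithin f (n + 1) a c := by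
  obtain ⟨m, hm, e⟩ := h'
  refine ⟨m + 1, by omega, ?_⟩
  rw [Function.iterate_succ_apply]
  have : flip bind f (some a) = some b := h
  rw [this, e]

theorem single (h : f a = some b) : EvalsWithin f 1 a b := head h (refl b)

theorem trans (h : EvalsWithin f m a b) (h' : EvalsWithin f n b c) :
    EvalsWithin f (m + n) a c := by
  obtain ⟨p, hp, e⟩ := h
  obtain ⟨q, hq, e'⟩ := h'
  exact ⟨q + p, by omega, by rw [Function.iterate_add_apply, e, e']⟩

theorem mono (h : EvalsWithin f m a b) (hmn : m ≤ n) : EvalsWithin f n a b := by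
  obtain ⟨p, hp, e⟩ := h
  exact ⟨p, hp.trans hmn, e⟩

theorem of_le_of_eq {a' b' : α} (h : EvalsWithin f m a b) (hmn : m ≤ n) (ha : a = a')
    (hb : b = b') : EvalsWithin f n a' b' :=
  ha ▸ hb ▸ h.mono hmn

theorem nonempty_evalsToInTime (h : EvalsWithin f n a b) :
    Nonempty (StateTransition.EvalsToInTime f a (some b) n) := by
  obtain ⟨p, hp, e⟩ := h
  exact ⟨⟨⟨p, e⟩, hp⟩⟩

end EvalsWithin

/-! ### Colouring rules and the stacks of the machine -/

/-- A rule for colouring the vertices of a graph one after the other by the colours `Option ι`: the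
row of the vertex in the adjacency matrix and the current colours are read in parallel by a finite
automaton with states `A`, whose final state determines the colour of the vertex. -/
structure ColourRule (ι A : Type) where
  /-- The colour of the vertices that are not yet treated. -/
  start : ι
  /-- The initial state of the automaton. -/
  seed : A
  /-- The transition function of the automaton. -/
  upd : A → Bool → Option ι → A
  /-- The colour determined by the final state. -/
  dec : A → Option ι

namespace ColourRule

variable {ι A : Type} (R : ColourRule ι A)

/-- The state reached on a row of the adjacency matrix, when the vertices treated so far have the
colours in the given list. -/
def foldRow : A → List Bool → List (Option ι) → A
  | a, [], _ => a
  | a, b :: r, [] => foldRow (R.upd a b (some R.start)) r []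
  | a, b :: r, c :: cs => foldRow (R.upd a b c) r cs

/-- The colours after the given rows are treated. -/
def colourRows : List (List Bool) → List (Option ι) → List (Option ι)
  | [], cs => cs
  | r :: rs, cs => colourRows rs (cs ++ [R.dec (R.foldRow R.seed r cs)])

theorem length_colourRows (ws : List (List Bool)) (f : List (Option ι)) :
    (R.colourRows ws f).length = f.length + ws.length := by
  induction ws generalizing f with
  | nil => simp [colourRows]
  | cons w ws ih => simp [colourRows, ih]; omega

end ColourRule

/-- The stacks of the machine: input, output, the colours of the treated vertices in order and
reversed, and one counter per colour. -/
inductive Stack (ι : Type)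
  | inp | out | fwd | rev
  | cnt (c : ι)
deriving DecidableEq, Fintype

/-- The labels of the machine. -/
inductive Label (ι : Type)
  | read | back | count | fight | write
  | incr (c : ι)
deriving Fintype

/-- The stack alphabets of the machine. -/
abbrev Alphabet (ι : Type) : Stack ι → Type
  | .inp => Option Bool
  | .out => Bool
  | .fwd => Option ι
  | .rev => Option ι
  | .cnt _ => Unit

/-- The internal states of the machine. -/
structure State (ι A : Type) where
  /-- The input symbol read last. -/
  sym : Option (Option Bool)
  /-- The colour read last. -/
  col : Option (Option ι)
  /-- The state of the automaton of the colouring rule. -/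
  acc : A
  /-- The last colour whose counter was found to be nonzero. -/
  best : ι
  /-- Whether a nonzero counter was found in the current round. -/
  found : Bool
deriving Fintype

/-- Clear the registers and continue at a label. -/
def jump {ι A : Type} (l : Label ι) : TM2.Stmt (Alphabet ι) (Label ι) (State ι A) :=
  load (fun s => { s with sym := none, col := none, found := false }) (goto fun _ => l)

/-- Decrease all counters in a list, and record which one was nonzero. -/
def decrease {ι A : Type} (q : TM2.Stmt (Alphabet ι) (Label ι) (State ι A)) :
    List ι → TM2.Stmt (Alphabet ι) (Label ι) (State ι A)
  | [] => q
  | c :: l => pop (.cnt c)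
      (fun s o => if o.isSome then { s with best := c, found := true } else s) (decrease q l)

namespace ColourRule

variable {ι A : Type} (R : ColourRule ι A) [DecidableEq ι]

/-- A state with empty registers. -/
def idle (a : A) (b : ι) : State ι A := ⟨none, none, a, b, false⟩

/-- The stacks with the given contents. -/
def tapes (i : List (Option Bool)) (o : List Bool) (f r : List (Option ι)) (g : ι → ℕ) :
    ∀ s, List (Alphabet ι s)
  | .inp => i
  | .out => o
  | .fwd => f
  | .rev => r
  | .cnt c => List.replicate (g c) ()

section Update

variable (i i' : List (Option Bool)) (o o' : List Bool) (f f' r r' : List (Option ι)) (g : ι → ℕ)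

@[simp] theorem update_inp :
    Function.update (tapes i o f r g) .inp i' = tapes i' o f r g := by
  funext s; cases s <;> simp [tapes, Function.update]

@[simp] theorem update_out :
    Function.update (tapes i o f r g) .out o' = tapes i o' f r g := by
  funext s; cases s <;> simp [tapes, Function.update]

@[simp] theorem update_fwd :
    Function.update (tapes i o f r g) .fwd f' = tapes i o f' r g := by
  funext s; cases s <;> simp [tapes, Function.update]

@[simp] theorem update_rev :
    Function.update (tapes i o f r g) .rev r' = tapes i o f r' g := by
  funext s; cases s <;> simp [tapes, Function.update]

theorem update_cnt (c : ι) (m : ℕ) :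
    Function.update (tapes i o f r g) (.cnt c) (List.replicate m ()) =
      tapes i o f r (Function.update g c m) := by
  funext s
  rcases s with _ | _ | _ | _ | d
  iterate 4 simp [tapes, Function.update]
  by_cases h : d = c
  · subst h; simp [tapes]
  · simp [tapes, h]

end Update

/-- A whole round of decrements is one statement, hence part of a single machine step. Which nonzero
counter gets recorded is irrelevant; it only matters that its value before the round was positive.
-/
theorem stepAux_decrease (q : TM2.Stmt (Alphabet ι) (Label ι) (State ι A)) (i : List (Option Bool))
    (o : List Bool) (f r : List (Option ι)) (g : ι → ℕ) (l : List ι)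
    (hl : l.Nodup) (s : State ι A) :
    ∃ b' t, TM2.stepAux (decrease q l) s (tapes i o f r g) =
        TM2.stepAux q { s with best := b', found := t }
          (tapes i o f r fun c => if c ∈ l then g c - 1 else g c) ∧
      (t = true ∧ b' ∈ l ∧ 0 < g b' ∨ t = s.found ∧ b' = s.best ∧ ∀ c ∈ l, g c = 0) := by
  induction l generalizing s g with
  | nil => exact ⟨s.best, s.found, by simp [decrease], by simp⟩
  | cons c l ih =>
    rw [List.nodup_cons] at hl
    obtain ⟨b', t, e, h⟩ := ih (Function.update g c (g c - 1)) hl.2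
      (if 0 < g c then { s with best := c, found := true } else s)
    refine ⟨b', t, ?_, ?_⟩
    · simp only [decrease, TM2.stepAux]
      have h1 : (tapes i o f r g (.cnt c)).tail = List.replicate (g c - 1) () := by
        simp [tapes]
      have h2 : (tapes i o f r g (.cnt c)).head?.isSome = decide (0 < g c) := by
        simp only [tapes]
        cases g c <;> simp [List.replicate_succ]
      rw [h1, h2, update_cnt]
      simp only [decide_eq_true_eq]
      rw [e]
      congr 1
      · split_ifs <;> rfl
      · congr 1
        funext d
        by_cases hd : d = c
        · subst hd; simp [hl.1]
        · simp [hd]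
    · have hu : ∀ d ∈ l, Function.update g c (g c - 1) d = g d := fun d hd =>
        Function.update_of_ne (fun h : d = c => hl.1 (h ▸ hd)) _ _
      rcases h with ⟨ht, hb, hp⟩ | ⟨ht, hb, hz⟩
      · rw [hu _ hb] at hp
        exact .inl ⟨ht, List.mem_cons_of_mem _ hb, hp⟩
      · by_cases hc : 0 < g c
        · rw [if_pos hc] at ht hb
          subst hb
          exact .inl ⟨ht, List.mem_cons_self, hc⟩
        · rw [if_neg hc] at ht hb
          refine .inr ⟨ht, hb, fun d hd => ?_⟩
          rcases List.mem_cons.1 hd with rfl | hd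
          · omega
          · rw [← hu d hd, hz d hd]

/-! ### The program, its runs and their length -/

variable [Fintype ι]

/-- The program of the machine. -/
noncomputable def program : Label ι → TM2.Stmt (Alphabet ι) (Label ι) (State ι A)
  | .read =>
    pop .inp (fun s o => { s with sym := o }) <|
    branch (fun s => s.sym.isNone) (jump .count) <|
    branch (fun s => s.sym == some none)
      (push .rev (fun s => R.dec s.acc) <|
        load (fun s => { s with acc := R.seed }) <| jump .back) <|
    pop .fwd (fun s o => { s with
      col := o
      acc := R.upd s.acc (s.sym == some (some true)) (o.getD (some R.start)) }) <|
    branch (fun s => s.col.isSome)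
      (push .rev (fun s => s.col.getD none) <| jump .read)
      (jump .read)
  | .back =>
    pop .rev (fun s o => { s with col := o }) <|
    branch (fun s => s.col.isSome)
      (push .fwd (fun s => s.col.getD none) <| jump .back)
      (jump .read)
  | .count =>
    pop .fwd (fun s o => { s with col := o }) <|
    branch (fun s => s.col.isSome)
      (push .rev (fun s => s.col.getD none) <|
        branch (fun s => (s.col.getD none).isSome)
          (goto fun s => .incr ((s.col.getD none).getD R.start))
          (jump .count))
      (jump .fight)
  | .incr c => push (.cnt c) (fun _ => ()) <| jump .count
  | .fight =>
    decrease (branch (fun s => s.found) (jump .fight) (jump .write)) Finset.univ.toList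
  | .write =>
    pop .rev (fun s o => { s with col := o }) <|
    branch (fun s => s.col.isSome)
      (push .out (fun s => s.col.getD none == some s.best) <| jump .write)
      (load (fun s => { s with best := R.start, sym := none, col := none, found := false }) halt)

/-- The configuration with the given label, state and stacks. -/
abbrev cfg (l : Label ι) (a : A) (b : ι) (i : List (Option Bool)) (o : List Bool)
    (f r : List (Option ι)) (g : ι → ℕ) : TM2.Cfg (Alphabet ι) (Label ι) (State ι A) :=
  ⟨some l, idle a b, tapes i o f r g⟩

variable (a : A) (b : ι) (i : List (Option Bool)) (o : List Bool) (f r : List (Option ι))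
  (g : ι → ℕ)

theorem step_read_nil : TM2.step R.program (cfg .read a b [] o f r g) =
    some (cfg .count a b [] o f r g) := by
  simp [cfg, program, jump, tapes, idle]

theorem step_read_none : TM2.step R.program (cfg .read a b (none :: i) o f r g) =
    some (cfg .back R.seed b i o f (R.dec a :: r) g) := by
  simp [cfg, program, jump, tapes, idle]

theorem step_read_some_nil (x : Bool) :
    TM2.step R.program (cfg .read a b (some x :: i) o [] r g) =
      some (cfg .read (R.upd a x (some R.start)) b i o [] r g) := by
  cases x <;> simp [cfg, program, jump, tapes, idle]

theorem step_read_some_cons (x : Bool) (c : Option ι) :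
    TM2.step R.program (cfg .read a b (some x :: i) o (c :: f) r g) =
      some (cfg .read (R.upd a x c) b i o f (c :: r) g) := by
  cases x <;> simp [cfg, program, jump, tapes, idle]

theorem step_back_nil : TM2.step R.program (cfg .back a b i o f [] g) =
    some (cfg .read a b i o f [] g) := by
  simp [cfg, program, jump, tapes, idle]

theorem step_back_cons (c : Option ι) : TM2.step R.program (cfg .back a b i o f (c :: r) g) =
    some (cfg .back a b i o (c :: f) r g) := by
  simp [cfg, program, jump, tapes, idle]

theorem step_count_nil : TM2.step R.program (cfg .count a b i o [] r g) =
    some (cfg .fight a b i o [] r g) := by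
  simp [cfg, program, jump, tapes, idle]

theorem step_write_cons (c : Option ι) :
    TM2.step R.program (cfg .write a b i o f (c :: r) g) =
      some (cfg .write a b i ((c == some b) :: o) f r g) := by
  simp [cfg, program, jump, tapes, idle]

/-- Halting requires the initial internal state, so `best` is reset to `R.start`. -/
theorem step_write_nil : TM2.step R.program (cfg .write a b i o f [] g) =
    some ⟨none, idle a R.start, tapes i o f [] g⟩ := by
  simp [cfg, program, tapes, idle]

theorem step_count_none : TM2.step R.program (cfg .count a b i o (none :: f) r g) =
    some (cfg .count a b i o f (none :: r) g) := by
  simp [cfg, program, jump, tapes, idle]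

theorem evals_count_some (c : ι) :
    EvalsWithin (TM2.step R.program) 2 (cfg .count a b i o (some c :: f) r g)
      (cfg .count a b i o f (some c :: r) (Function.update g c (g c + 1))) := by
  refine .head (b := ⟨some (.incr c), ⟨none, some (some c), a, b, false⟩,
    tapes i o f (some c :: r) g⟩) ?_ (.single ?_)
  · simp [program, tapes, idle]
  · simp only [program, jump, TM2.step, TM2.stepAux, idle, tapes, cfg]
    rw [← List.replicate_succ, update_cnt]

theorem evals_count : EvalsWithin (TM2.step R.program) (2 * f.length + 1)
    (cfg .count a b i o f r g)
    (cfg .fight a b i o [] (f.reverse ++ r) fun c => g c + f.count (some c)) := by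
  induction f generalizing r g with
  | nil => simpa using EvalsWithin.single (R.step_count_nil a b i o r g)
  | cons c f ih =>
    cases c with
    | none =>
      refine (EvalsWithin.head (R.step_count_none a b i o f r g) (ih _ _)).of_le_of_eq ?_ rfl ?_
      · simp
      · simp
    | some c =>
      refine ((R.evals_count_some a b i o f r g c).trans (ih _ _)).of_le_of_eq ?_ rfl ?_
      · simp; omega
      · simp only [List.reverse_cons, List.append_assoc, List.singleton_append]
        congr 2
        funext d
        by_cases h : d = c
        · subst h; simp; omega
        · simp [h, Ne.symm h]

theorem evals_write : EvalsWithin (TM2.step R.program) (r.length + 1)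
    (cfg .write a b i o f r g)
    ⟨none, idle a R.start, tapes i ((r.reverse.map (· == some b)) ++ o) f [] g⟩ := by
  induction r generalizing o with
  | nil => simpa using EvalsWithin.single (R.step_write_nil a b i o f g)
  | cons c r ih => simpa using EvalsWithin.head (R.step_write_cons a b i o f r g c) (ih _)

theorem step_fight : ∃ b',
    (TM2.step R.program (cfg .fight a b i o f r g) =
        some (cfg .fight a b' i o f r fun c => g c - 1) ∧ 0 < g b') ∨
      (TM2.step R.program (cfg .fight a b i o f r g) =
        some (cfg .write a b i o f r fun c => g c - 1) ∧ ∀ c, g c = 0) := by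
  obtain ⟨b', t, e, h⟩ := stepAux_decrease
    (branch (fun s => s.found) (jump .fight) (jump .write)) i o f r g Finset.univ.toList
    (Finset.nodup_toList _) (idle a b)
  refine ⟨b', ?_⟩
  rw [TM2.step, program, e]
  rcases h with ⟨rfl, -, h⟩ | ⟨rfl, rfl, h⟩
  · exact .inl ⟨by simp [jump, idle], h⟩
  · exact .inr ⟨by simp [jump, idle], fun c => h c (by simp)⟩

/-- When all counters drop together, a colour recorded in the last round that found a nonzero
counter has a maximal counter. The clause `g b' = 0 → b' = b` strengthens the induction: the
register changes only to a colour with a positive counter. -/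
theorem evals_fight (m : ℕ) (hm : ∀ c, g c ≤ m) : ∃ b',
    EvalsWithin (TM2.step R.program) (m + 1) (cfg .fight a b i o f r g)
      (cfg .write a b' i o f r fun _ => 0) ∧
    (∀ c, g c ≤ g b') ∧ (g b' = 0 → b' = b) := by
  induction m generalizing b g with
  | zero =>
    obtain rfl : g = fun _ => 0 := funext fun c => Nat.le_zero.1 (hm c)
    obtain ⟨b', h | h⟩ := R.step_fight a b i o f r fun _ => 0
    · exact absurd h.2 (lt_irrefl _)
    · exact ⟨b, .single h.1, fun _ => le_rfl, fun _ => rfl⟩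
  | succ m ih =>
    obtain ⟨b', h | h⟩ := R.step_fight a b i o f r g
    · obtain ⟨d, e, h1, h2⟩ := ih b' (fun c => g c - 1) fun c => by have := hm c; omega
      -- Truncated subtraction hides the difference between 0 and 1, so `g c - 1 ≤ g d - 1` gives `g
      -- c ≤ g d` only once `g d` is known to be positive.
      have hd : 0 < g d := by
        by_contra hd
        have := h2 (by omega)
        subst this
        exact hd h.2
      refine ⟨d, .head h.1 e, fun c => ?_, fun h => by omega⟩
      have := h1 c
      omega
    · obtain rfl : g = fun _ => 0 := funext h.2
      exact ⟨b, (EvalsWithin.single h.1).mono (by omega), fun _ => le_rfl, fun _ => rfl⟩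

theorem evals_back : EvalsWithin (TM2.step R.program) (r.length + 1)
    (cfg .back a b i o f r g) (cfg .read a b i o (r.reverse ++ f) [] g) := by
  induction r generalizing f with
  | nil => simpa using EvalsWithin.single (R.step_back_nil a b i o f g)
  | cons c r ih => simpa using EvalsWithin.head (R.step_back_cons a b i o f r g c) (ih _)

/-- The length hypothesis ensures that `.fwd` is used up, so that all colours have moved to `.rev`
when the row ends. -/
theorem evals_read (w : List Bool) (hw : f.length ≤ w.length) :
    EvalsWithin (TM2.step R.program) w.length
      (cfg .read a b (w.map some ++ i) o f r g)
      (cfg .read (R.foldRow a w f) b i o [] (f.reverse ++ r) g) := by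
  induction w generalizing a f r with
  | nil =>
    obtain rfl : f = [] := List.length_eq_zero_iff.1 (Nat.le_zero.1 hw)
    simpa [foldRow] using EvalsWithin.refl _
  | cons x w ih =>
    cases f with
    | nil =>
      simpa [foldRow] using EvalsWithin.head (R.step_read_some_nil a b _ o r g x)
        (ih (R.upd a x (some R.start)) [] r (by simp))
    | cons c f =>
      simpa [foldRow] using EvalsWithin.head (R.step_read_some_cons a b _ o f r g x c)
        (ih (R.upd a x c) f (c :: r) (by simpa using hw))

theorem evals_row (w : List Bool) (hw : f.length ≤ w.length) :
    EvalsWithin (TM2.step R.program) (2 * w.length + 3)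
      (cfg .read R.seed b (w.map some ++ none :: i) o f [] g)
      (cfg .read R.seed b i o (f ++ [R.dec (R.foldRow R.seed w f)]) [] g) := by
  refine ((R.evals_read R.seed b (none :: i) o f [] g w hw).trans
    (.head (R.step_read_none _ b i o [] _ g)
      (R.evals_back R.seed b i o [] _ g))).of_le_of_eq ?_ rfl ?_
  · simp; omega
  · simp

/-- The word formed by the given rows. -/
def rowsWord (ws : List (List Bool)) : List (Option Bool) :=
  (ws.map fun w => w.map some ++ [none]).flatten

theorem evals_rows (n : ℕ) (ws : List (List Bool)) (hw : ∀ w ∈ ws, w.length = n)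
    (hf : f.length + ws.length ≤ n) :
    EvalsWithin (TM2.step R.program) (ws.length * (2 * n + 3))
      (cfg .read R.seed b (rowsWord ws ++ i) o f [] g)
      (cfg .read R.seed b i o (R.colourRows ws f) [] g) := by
  induction ws generalizing f with
  | nil => simpa [rowsWord, colourRows] using EvalsWithin.refl _
  | cons w ws ih =>
    have h0 : w.length = n := hw w (by simp)
    simp only [List.length_cons] at hf
    refine ((R.evals_row b (rowsWord ws ++ i) o f g w (by omega)).trans
      (ih (f ++ [R.dec (R.foldRow R.seed w f)]) (fun w h => hw w (by simp [h]))
        (by simp; omega))).of_le_of_eq ?_ ?_ rfl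
    · simp only [List.length_cons, h0]
      nlinarith
    · simp [rowsWord]

/-- The machine writes the characteristic word of a largest colour class. -/
theorem evals_program (n : ℕ) (ws : List (List Bool)) (hw : ∀ w ∈ ws, w.length = n)
    (hn : ws.length = n) : ∃ b,
    EvalsWithin (TM2.step R.program) (n * (2 * n + 3) + 4 * n + 4)
      (cfg .read R.seed R.start (rowsWord ws) [] [] [] fun _ => 0)
      ⟨none, idle R.seed R.start,
        tapes [] ((R.colourRows ws []).map (· == some b)) [] [] fun _ => 0⟩ ∧
    ∀ c, (R.colourRows ws []).count (some c) ≤ (R.colourRows ws []).count (some b) := by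
  have hl : (R.colourRows ws []).length = n := by simp [length_colourRows, hn]
  obtain ⟨b, e, h, -⟩ := R.evals_fight R.seed R.start [] [] []
    (R.colourRows ws []).reverse (fun c => (R.colourRows ws []).count (some c)) n
    fun c => hl ▸ List.count_le_length
  refine ⟨b, ?_, h⟩
  have e1 := R.evals_rows R.start [] [] [] (fun _ => 0) n ws hw (by simp [hn])
  have e2 := EvalsWithin.single
    (R.step_read_nil R.seed R.start [] (R.colourRows ws []) [] fun _ => 0)
  have e3 := R.evals_count R.seed R.start [] [] (R.colourRows ws []) [] fun _ => 0
  have e4 := R.evals_write R.seed b [] [] [] (R.colourRows ws []).reverse fun _ => 0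
  simp only [List.append_nil, zero_add, List.reverse_reverse, List.length_reverse, hl, hn]
    at e1 e2 e3 e4
  -- Besides the rows: 1 step to leave `.read`, at most `2 * n + 1` to count, `n + 1` to fight and
  -- `n + 1` to write.
  exact ((((e1.trans e2).trans e3).trans e).trans e4).mono (by omega)

/-- The machine of a colouring rule. -/
noncomputable def machine [Fintype A] : FinTM2 where
  K := Stack ι
  k₀ := .inp
  k₁ := .out
  Γ := Alphabet ι
  Λ := Label ι
  main := .read
  σ := State ι A
  initialState := idle R.seed R.start
  Γk₀Fin := inferInstanceAs (Fintype (Option Bool))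
  m := R.program

/-- The colours that the rule gives to the vertices of a graph. -/
noncomputable def colours {n : ℕ} (G : SimpleGraph (Fin n)) : List (Option ι) :=
  open Classical in R.colourRows (List.ofFn fun i => List.ofFn fun j => decide (G.Adj i j)) []

/-- The colour `b x` is read off from the run, since the machine itself decides between classes of
equal size. -/
theorem exists_computable [Fintype A] : ∃ b : Instance → ι,
    Nonempty (TM2ComputableInPolyTime encodeInstance (id : List Bool → List Bool)
      fun x => (R.colours x.2).map (· == some (b x))) ∧
    ∀ x c, (R.colours x.2).count (some c) ≤ (R.colours x.2).count (some (b x)) := by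
  classical
  have key (x : Instance) := R.evals_program x.1
    (List.ofFn fun i => List.ofFn fun j => decide (x.2.Adj i j)) (by simp [List.mem_ofFn])
    (by simp)
  choose b e h using key
  refine ⟨b, ⟨{
    tm := R.machine
    inputAlphabet := .refl _
    outputAlphabet := .refl _
    time := 6 * Polynomial.X + 4
    outputsFun := fun x => Classical.choice ?_ }⟩, h⟩
  refine ((e x).of_le_of_eq ?_ ?_ ?_).nonempty_evalsToInTime
  · rw [encodeInstance_length]
    -- The input length is `n * (n + 1)`, and `2n² + 7n + 4 ≤ 6n(n + 1) + 4` because `n ≤ n²`.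
    have := Nat.le_mul_self x.1
    simp
    nlinarith
  · simp only [initList, cfg]
    congr 1
    funext s
    cases s <;> simp [tapes, machine, rowsWord, encodeInstance, encodeRow, List.map_ofFn,
      Function.comp_def]
    rfl
  · simp only [haltList]
    congr 1
    funext s
    cases s <;> simp [tapes, machine, colours]
    rfl

end ColourRule

namespace ColourRule

variable {ι A : Type} (R : ColourRule ι A)

theorem foldRow_cons (a : A) (x : Bool) (w : List Bool) (cs : List (Option ι)) :
    R.foldRow a (x :: w) cs = R.foldRow (R.upd a x (cs.getD 0 (some R.start))) w cs.tail := by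
  cases cs <;> simp [foldRow]

theorem colourRows_concat (ws : List (List Bool)) (w : List Bool) (cs : List (Option ι)) :
    R.colourRows (ws ++ [w]) cs =
      R.colourRows ws cs ++ [R.dec (R.foldRow R.seed w (R.colourRows ws cs))] := by
  induction ws generalizing cs with
  | nil => simp [colourRows]
  | cons v ws ih => simp [colourRows, ih]

end ColourRule

/-! ### Capped neighbour counts and the greedy choice -/

section Tally

variable {k : ℕ}

/-- The numbers of neighbours of the various colours, counted up to `k`. -/
abbrev Tally (k : ℕ) : Type := Option (Fin (k + 1)) → Fin (k + 1)

/-- The three cases of the greedy choice, expressed by capped counts alone. -/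
theorem exists_colour (a : Tally k) : ∃ d : Option (Fin (k + 1)),
    (∃ c, d = some c ∧ k ≤ ∑ c' ∈ Finset.univ.erase (some c), (a c' : ℕ) ∧
      (c = 0 ∨ a (some c) = 0)) ∨
    (d = none ∧ ∑ c', (a c' : ℕ) < k) := by
  by_cases h0 : k ≤ ∑ c' ∈ Finset.univ.erase (some 0), (a c' : ℕ)
  · exact ⟨some 0, .inl ⟨0, rfl, h0, .inl rfl⟩⟩
  by_cases h1 : ∑ c', (a c' : ℕ) < k
  · exact ⟨none, .inr ⟨rfl, h1⟩⟩
  obtain ⟨c, hc0, hc⟩ : ∃ c : Fin (k + 1), c ≠ 0 ∧ a (some c) = 0 := by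
    -- If all `k` nonzero colours occurred, they would already contribute `k` to the sum without
    -- colour 0.
    by_contra! h
    refine h0 ?_
    calc k = ∑ c ∈ Finset.univ.erase (0 : Fin (k + 1)), 1 := by simp
      _ ≤ ∑ c ∈ Finset.univ.erase (0 : Fin (k + 1)), (a (some c) : ℕ) := by
        refine Finset.sum_le_sum fun c hc => Nat.one_le_iff_ne_zero.2 fun e => ?_
        exact h c (Finset.ne_of_mem_erase hc) (Fin.ext e)
      _ = ∑ c' ∈ (Finset.univ.erase (0 : Fin (k + 1))).map .some, (a c' : ℕ) :=
        (Finset.sum_map _ Function.Embedding.some fun c' => (a c' : ℕ)).symm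
      _ ≤ _ := by
        refine Finset.sum_le_sum_of_subset fun c' hc' => ?_
        obtain ⟨c, hc, rfl⟩ := Finset.mem_map.1 hc'
        simpa using hc
  refine ⟨some c, .inl ⟨c, rfl, ?_, .inr hc⟩⟩
  have := Finset.add_sum_erase Finset.univ (fun c' => (a c' : ℕ)) (Finset.mem_univ (some c))
  simp only [hc, Fin.val_zero, zero_add] at this
  omega

/-- Keep the start colour if enough neighbours have other colours; otherwise discard the vertices
of degree less than `k`, and give the others a colour that does not occur among their neighbours. -/
noncomputable def tallyRule (k : ℕ) : ColourRule (Fin (k + 1)) (Tally k) where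
  start := 0
  seed _ := 0
  upd a x c := if x then Function.update a c ⟨min k (a c + 1), by omega⟩ else a
  dec a := (exists_colour a).choose

/-- Capping after every increment has the same effect as capping once at the end. Vertices beyond
the end of `cs` are untreated and count with the start colour. -/
theorem foldRow_ofFn {n : ℕ} (g : Fin n → Bool) (a : Tally k) (cs : List (Option (Fin (k + 1))))
    (c : Option (Fin (k + 1))) :
    ((tallyRule k).foldRow a (List.ofFn g) cs c : ℕ) =
      min k (a c + ∑ j, if g j = true ∧ cs.getD j (some 0) = c then 1 else 0) := by
  induction n generalizing a cs with
  | zero =>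
    have := (a c).2
    simp [ColourRule.foldRow]
    omega
  | succ n ih =>
    rw [List.ofFn_succ, ColourRule.foldRow_cons, ih, Fin.sum_univ_succ]
    have ht (j : ℕ) : cs.tail.getD j (some 0) = cs.getD (j + 1) (some 0) := by
      cases cs <;> simp
    simp only [ht, Fin.val_succ, Fin.val_zero]
    cases hx : g 0
    · simp [tallyRule]
    · by_cases hc : cs.getD 0 (some 0) = c
      · subst hc
        simp only [tallyRule, if_true, Function.update_self, and_self]
        omega
      · have hc' : c ≠ cs.getD 0 (some (tallyRule k).start) := fun e => hc e.symm
        simp only [tallyRule, if_true] at hc' ⊢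
        rw [Function.update_of_ne hc', if_neg fun h => hc h.2, zero_add]

end Tally

/-! ### Settled vertices and the sizes of the colour classes -/

section Colouring

open Classical in
/-- A vertex is settled by a colouring if it is discarded and has degree less than `k`, or if at
least `k` of its neighbours have other colours. -/
def Settled {V ι : Type} [Fintype V] (G : SimpleGraph V) (k : ℕ) (col : V → Option ι) (v : V) :
    Prop :=
  (∀ c, col v = some c → k ≤ (Finset.univ.filter fun u => G.Adj v u ∧ col u ≠ some c).card) ∧
    (col v = none → (Finset.univ.filter fun u => G.Adj v u).card < k)

open Classical in
/-- Changing the colour of one vertex from `c₀` to `d` keeps the other vertices settled, if `d` is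
`c₀` or does not occur among its neighbours. -/
theorem Settled.update {V ι : Type} [Fintype V] [DecidableEq V] {G : SimpleGraph V} {k : ℕ}
    {col : V → Option ι} {v w : V} {d : Option ι} (h : Settled G k col w) (hw : w ≠ v)
    (hd : ∀ c, d = some c → col v = some c ∨ ∀ u, G.Adj v u → col u ≠ some c) :
    Settled G k (Function.update col v d) w := by
  refine ⟨fun c hc => ?_, fun hc => ?_⟩
  · rw [Function.update_of_ne hw] at hc
    refine (h.1 c hc).trans (Finset.card_le_card fun u hu => ?_)
    simp only [Finset.mem_filter, Finset.mem_univ, true_and] at hu ⊢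
    refine ⟨hu.1, ?_⟩
    by_cases hv : u = v
    · subst hv
      rw [Function.update_self]
      intro e
      rcases hd c e with h' | h'
      · exact hu.2 h'
      -- Here `w` is itself a neighbour of `v` with colour `c`, which the choice of `d` excludes.
      · exact h' w hu.1.symm hc
    · rw [Function.update_of_ne hv]
      exact hu.2
  · rw [Function.update_of_ne hw] at hc
    exact h.2 hc

-- Since `v` is not its own neighbour, recolouring it leaves the tally of its neighbourhood valid.
open Classical in
theorem settled_update_self {V : Type} [Fintype V] [DecidableEq V] {G : SimpleGraph V} {k : ℕ}
    {col : V → Option (Fin (k + 1))} {v : V} {a : Tally k}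
    (ha : ∀ c, (a c : ℕ) = min k (Finset.univ.filter fun u => G.Adj v u ∧ col u = c).card) :
    Settled G k (Function.update col v ((tallyRule k).dec a)) v := by
  have hu (u) (h : G.Adj v u) (d : Option (Fin (k + 1))) : Function.update col v d u = col u :=
    Function.update_of_ne h.ne' _ _
  have hsum (s : Finset (Option (Fin (k + 1)))) :
      (Finset.univ.filter fun u => G.Adj v u ∧ col u ∈ s).card =
        ∑ c ∈ s, (Finset.univ.filter fun u => G.Adj v u ∧ col u = c).card := by
    rw [Finset.card_eq_sum_card_fiberwise (f := col) (t := s) (by intro u; simp)]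
    refine Finset.sum_congr rfl fun c hc => ?_
    congr 1
    ext u
    simp only [Finset.mem_filter, Finset.mem_univ, true_and]
    constructor
    · rintro ⟨⟨h1, -⟩, h2⟩
      exact ⟨h1, h2⟩
    · rintro ⟨h1, h2⟩
      exact ⟨⟨h1, h2 ▸ hc⟩, h2⟩
  have hdec := (exists_colour a).choose_spec
  change (∃ c, (tallyRule k).dec a = some c ∧ _) ∨ ((tallyRule k).dec a = none ∧ _) at hdec
  refine ⟨fun c hc => ?_, fun hc => ?_⟩
  · rw [Function.update_self] at hc
    rcases hdec with ⟨c', e, h, -⟩ | ⟨e, -⟩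
    · obtain rfl : c' = c := by simpa [e] using hc
      calc k ≤ _ := h
        _ ≤ ∑ c ∈ Finset.univ.erase (some c'),
            (Finset.univ.filter fun u => G.Adj v u ∧ col u = c).card :=
          Finset.sum_le_sum fun c _ => (ha c).trans_le (min_le_right _ _)
        _ = _ := (hsum _).symm
        _ ≤ _ := Finset.card_le_card fun u => by
          simp only [Finset.mem_filter, Finset.mem_univ, true_and, Finset.mem_erase, and_true]
          rintro ⟨h1, h2⟩
          exact ⟨h1, by rwa [hu u h1]⟩
    · simp [e] at hc
  · rw [Function.update_self] at hc
    rcases hdec with ⟨c', e, -⟩ | ⟨-, h⟩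
    · simp [e] at hc
    · have := hsum Finset.univ
      simp only [Finset.mem_univ, and_true] at this
      rw [this]
      refine lt_of_eq_of_lt (Finset.sum_congr rfl fun c _ => ?_) h
      -- A capped sum below `k` means that no count reached the cap, so the counts are exact.
      have h1 : (a c : ℕ) ≤ ∑ c', (a c' : ℕ) :=
        Finset.single_le_sum (f := fun c' => (a c' : ℕ)) (fun _ _ => Nat.zero_le _)
          (Finset.mem_univ c)
      have := ha c
      omega

-- This is the hypothesis on the new colour in `Settled.update`. As `k` is positive, a capped count
-- vanishes only if the true count does.
open Classical in
theorem tallyRule_dec {V : Type} [Fintype V] {G : SimpleGraph V} {k : ℕ} (hk : 0 < k)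
    {col : V → Option (Fin (k + 1))} {v : V} (hv : col v = some 0) {a : Tally k}
    (ha : ∀ c, (a c : ℕ) = min k (Finset.univ.filter fun u => G.Adj v u ∧ col u = c).card) :
    ∀ c, (tallyRule k).dec a = some c → col v = some c ∨ ∀ u, G.Adj v u → col u ≠ some c := by
  intro c hc
  have hdec := (exists_colour a).choose_spec
  change (∃ c, (tallyRule k).dec a = some c ∧ _) ∨ ((tallyRule k).dec a = none ∧ _) at hdec
  rcases hdec with ⟨c', e, -, h⟩ | ⟨e, -⟩
  · obtain rfl : c' = c := by simpa [e] using hc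
    rcases h with rfl | h
    · exact .inl hv
    · refine .inr fun u hu hcu => ?_
      have h0 := ha (some c')
      have : 0 < (Finset.univ.filter fun u => G.Adj v u ∧ col u = some c').card :=
        Finset.card_pos.2 ⟨u, by simp [hu, hcu]⟩
      rw [h, Fin.val_zero] at h0
      omega
  · simp [e] at hc

-- The invariant of the greedy algorithm: after `m` rows the first `m` vertices are settled, while
-- the default value of `getD` gives all later ones the start colour.
open Classical in
theorem settled_colourRows {n k : ℕ} (hk : 0 < k) (G : SimpleGraph (Fin n)) (m : ℕ) (hm : m ≤ n)
    (v : Fin n) (hv : v < m) :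
    Settled G k (fun u => ((tallyRule k).colourRows
      ((List.ofFn fun i => List.ofFn fun j => decide (G.Adj i j)).take m) []).getD u (some 0)) v := by
  induction m generalizing v with
  | zero => omega
  | succ m ih =>
    set ws := List.ofFn fun i => List.ofFn fun j => decide (G.Adj i j) with hws
    set cs := (tallyRule k).colourRows (ws.take m) [] with hcs
    have hl : cs.length = m := by
      simp [hcs, ColourRule.length_colourRows, hws]; omega
    set a := (tallyRule k).foldRow (tallyRule k).seed (List.ofFn fun j => decide (G.Adj ⟨m, hm⟩ j)) cs
    have htake : (tallyRule k).colourRows (ws.take (m + 1)) [] = cs ++ [(tallyRule k).dec a] := by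
      rw [List.take_succ_eq_append_getElem (by simp [hws]; omega), ColourRule.colourRows_concat]
      simp [hws, a, hcs]
    have hcol : (fun u : Fin n => (cs ++ [(tallyRule k).dec a]).getD u (some 0)) =
        Function.update (fun u : Fin n => cs.getD u (some 0)) ⟨m, hm⟩ ((tallyRule k).dec a) := by
      funext u
      by_cases hu : u = ⟨m, hm⟩
      · subst hu
        simp [hl]
      · rw [Function.update_of_ne hu]
        have hu' : (u : ℕ) ≠ m := fun e => hu (Fin.ext e)
        rcases lt_or_gt_of_ne hu' with h | h
        · rw [List.getD_append _ _ _ _ (by omega)]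
        · rw [List.getD_eq_default _ _ (by simp [hl]; omega), List.getD_eq_default _ _ (by omega)]
    have ha (c) : (a c : ℕ) =
        min k (Finset.univ.filter fun u : Fin n => G.Adj ⟨m, hm⟩ u ∧ cs.getD u (some 0) = c).card := by
      rw [foldRow_ofFn]
      simp [tallyRule]
    rw [htake, hcol]
    by_cases h : v = ⟨m, hm⟩
    · subst h
      exact settled_update_self ha
    · have h' : (v : ℕ) ≠ m := fun e => h (Fin.ext e)
      exact (ih (by omega) v (by omega)).update h
        (tallyRule_dec (col := fun u : Fin n => cs.getD u (some 0)) hk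
          (List.getD_eq_default _ _ hl.le) ha)

/-- The colouring of the vertices of a graph by the rule `tallyRule`. -/
noncomputable def colouring {n : ℕ} (G : SimpleGraph (Fin n)) (k : ℕ) (v : Fin n) :
    Option (Fin (k + 1)) :=
  ((tallyRule k).colours G).getD v (some 0)

theorem settled_colouring {n k : ℕ} (hk : 0 < k) (G : SimpleGraph (Fin n)) (v : Fin n) :
    Settled G k (colouring G k) v := by
  classical
  have := settled_colourRows hk G n le_rfl v v.2
  rwa [List.take_of_length_le (by simp)] at this

theorem ofFn_colouring {n k : ℕ} (G : SimpleGraph (Fin n)) :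
    List.ofFn (colouring G k) = (tallyRule k).colours G := by
  have hl : ((tallyRule k).colours G).length = n := by
    simp [ColourRule.colours, ColourRule.length_colourRows]
  refine List.ext_getElem (by simp [hl]) fun i h _ => ?_
  simp [colouring, hl, show i < n by simpa using h]

theorem count_ofFn {α : Type} [BEq α] [LawfulBEq α] [DecidableEq α] {n : ℕ} (f : Fin n → α)
    (a : α) :
    (List.ofFn f).count a = (Finset.univ.filter fun i => f i = a).card := by
  rw [Finset.card_filter]
  induction n with
  | zero => simp
  | succ n ih => rw [List.ofFn_succ, List.count_cons, ih, Fin.sum_univ_succ]; simp [add_comm]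

open Classical in
/-- A colour class of a colouring that settles all vertices is a `k`-nonblocker set. -/
theorem isKNonblocker_of_settled {V ι : Type} [Fintype V] {G : SimpleGraph V} {k : ℕ}
    {col : V → Option ι} (h : ∀ v, Settled G k col v) (c : ι) :
    IsKNonblocker G k (Finset.univ.filter fun v => col v = some c) := by
  intro x hx
  have hx : col x = some c := by simpa using hx
  refine ((h x).1 c hx).trans (Finset.card_le_card fun u => ?_)
  simp
  tauto

-- A member of a `k`-nonblocker set has `k` neighbours outside the set, hence degree at least `k`.
open Classical in
theorem maxKNonblocker_le_card_degree {V : Type} [Fintype V] (G : SimpleGraph V) (k : ℕ) :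
    maxKNonblocker G k ≤
      (Finset.univ.filter fun v => k ≤ (Finset.univ.filter fun u => G.Adj v u).card).card := by
  refine Finset.sup_le fun S hS => Finset.card_le_card fun v hv => ?_
  have h := (Finset.mem_filter.1 hS).2 v (by simpa using hv)
  simp only [Finset.mem_filter, Finset.mem_univ, true_and]
  refine h.trans (Finset.card_le_card fun u => ?_)
  simp

open Classical in
theorem maxKNonblocker_le_of_settled {V ι : Type} [Fintype V] [Fintype ι] {G : SimpleGraph V}
    {k : ℕ} {col : V → Option ι} (h : ∀ v, Settled G k col v) :
    maxKNonblocker G k ≤ ∑ c : ι, (Finset.univ.filter fun v => col v = some c).card := by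
  refine (maxKNonblocker_le_card_degree G k).trans ?_
  calc _ ≤ (Finset.univ.biUnion fun c : ι => Finset.univ.filter fun v => col v = some c).card := by
        refine Finset.card_le_card fun v hv => ?_
        simp only [Finset.mem_filter, Finset.mem_univ, true_and] at hv
        cases hc : col v with
        | none => exact absurd ((h v).2 hc) (by omega)
        | some c => simp [hc]
    _ ≤ _ := Finset.card_biUnion_le

end Colouring

end KNonblocker

/-! ### The approximation guarantee -/

theorem mainTheorem4 (k : ℕ) (hk : 1 < k) :
    ∃ S : (x : KNonblocker.Instance) → Finset (Fin x.1),
      Nonempty (Turing.TM2ComputableInPolyTime KNonblocker.encodeInstance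
        (id : List Bool → List Bool) (fun x => KNonblocker.encodeSet (S x))) ∧
      ∀ x : KNonblocker.Instance,
        KNonblocker.IsKNonblocker x.2 k (S x) ∧
        (KNonblocker.maxKNonblocker x.2 k : ℝ) / ((k : ℝ) + 1) - (k : ℝ) ≤
          ((S x).card : ℝ) := by
  classical
  obtain ⟨b, hb, hmax⟩ := (KNonblocker.tallyRule k).exists_computable
  have hset (x : KNonblocker.Instance) := KNonblocker.settled_colouring (k := k) (by omega) x.2
  refine ⟨fun x => Finset.univ.filter fun v => KNonblocker.colouring x.2 k v = some (b x), ?_,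
    fun x => ⟨?_, ?_⟩⟩
  · convert hb using 2
    funext x
    rw [← KNonblocker.ofFn_colouring, KNonblocker.encodeSet, List.map_ofFn]
    congr 1
    funext v
    simp [Bool.beq_eq_decide_eq]
  · convert KNonblocker.isKNonblocker_of_settled (hset x) (b x)
  · have h1 : KNonblocker.maxKNonblocker x.2 k ≤
        (k + 1) * (Finset.univ.filter fun v => KNonblocker.colouring x.2 k v = some (b x)).card := by
      refine (KNonblocker.maxKNonblocker_le_of_settled (hset x)).trans ?_
      refine (Finset.sum_le_card_nsmul _ _ (Finset.univ.filter fun v =>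
        KNonblocker.colouring x.2 k v = some (b x)).card fun c _ => ?_).trans_eq (by simp)
      -- Each of the `k + 1` classes is at most as large as the one that the machine outputs.
      have := hmax x c
      rw [← KNonblocker.ofFn_colouring, KNonblocker.count_ofFn, KNonblocker.count_ofFn] at this
      refine le_trans (le_of_eq ?_) (this.trans (le_of_eq ?_)) <;> congr!
    have h2 : (KNonblocker.maxKNonblocker x.2 k : ℝ) ≤ ((k : ℝ) + 1) *
        (Finset.univ.filter fun v => KNonblocker.colouring x.2 k v = some (b x)).card := by
      exact_mod_cast h1
    have h3 : (KNonblocker.maxKNonblocker x.2 k : ℝ) / ((k : ℝ) + 1) ≤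
        (Finset.univ.filter fun v => KNonblocker.colouring x.2 k v = some (b x)).card :=
      (div_le_iff₀' (by positivity)).2 h2
    have : (0 : ℝ) ≤ k := Nat.cast_nonneg k
    linarith
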